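/- Let $p$ be an odd prime and let $\Omega$ be an algebraically closed field of characteristic $0$; all fields below are subfields of $\Omega$, and $\zeta_{p^2}\in\Omega$ is a primitive $p^2$-th root of unity. A (possibly infinite) Galois extension $K/\mathbb{Q}$ has exponent $p$ if $\mathrm{Gal}(K/\mathbb{Q})$ has exponent $p$, and $K/\mathbb{Q}$ is unramified outside $p$ if no prime number $q\neq p$ ramifies in any finite subextension of $K/\mathbb{Q}$ (no condition is imposed at infinity). Then, among the abelian extensions $K/\mathbb{Q}$ of exponent $p$ that are unramified outside $p$, there is a largest one, i.e. one that contains all the others; it is cyclic over $\mathbb{Q}$, and it is the unique subfield of degree $p$ over $\mathbb{Q}$ of $\mathbb{Q}(\zeta_{p^2})$. -/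

import Mathlib

open scoped NumberField IntermediateField

/-- `K / F` is an abelian (Galois) extension, and its Galois group has exponent `m`. -/
def IntermediateField.IsAbelianOfExponent {F Ω : Type*} [Field F] [Field Ω] [Algebra F Ω]
    (K : IntermediateField F Ω) (m : ℕ) : Prop :=
  IsAbelianGalois F K ∧ Monoid.exponent Gal(K/F) = m

/-- `K / F` is a cyclic extension: it is Galois with cyclic Galois group. -/
def IntermediateField.IsCyclicExtension {F Ω : Type*} [Field F] [Field Ω] [Algebra F Ω]
    (K : IntermediateField F Ω) : Prop :=
  IsGalois F K ∧ IsCyclic Gal(K/F)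

/-- A (possibly infinite) algebraic extension `K / ℚ` inside `Ω` is unramified outside `p` if no
prime number `q ≠ p` ramifies in any finite subextension of `K`. Infinite places are ignored. -/
def UnramifiedOutside {Ω : Type*} [Field Ω] [Algebra ℚ Ω] (p : ℕ) (K : IntermediateField ℚ Ω) :
    Prop :=
  ∀ E : IntermediateField ℚ Ω, E ≤ K → FiniteDimensional ℚ E →
    ∀ q : ℕ, q.Prime → q ≠ p → Algebra.IsUnramifiedIn (𝓞 E) (Ideal.span {(q : ℤ)})

/-- The subfields `K` of `Ω` that are abelian over `ℚ`, with Galois group of exponent `p`,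
and unramified outside `p`. -/
def abelianExponentUnramifiedOutside (Ω : Type*) [Field Ω] [Algebra ℚ Ω] (p : ℕ) :
    Set (IntermediateField ℚ Ω) :=
  {K | K.IsAbelianOfExponent p ∧ UnramifiedOutside p K}

/-! The field ℚ(ζ) is cyclic of degree p(p-1), so it has a subfield L of degree p, which belongs to
the set. Everything else follows from a bound: an abelian number field of exponent dividing p,
unramified outside p, has degree at most p (`NumberField.finrank_le_of_isUnramifiedIn`). Applied to
the compositum of L with ℚ(x), for x in a competitor, it gives x ∈ L.

If the bound failed, some such E would have degree p². The inertia field at p is unramified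
everywhere, hence equals ℚ by Minkowski, so E is totally ramified at p. The contradiction comes from
`Valuation.false_of_totallyRamified_of_finrank_eq_sq`, a ramification group argument on E itself,
without completion. Let π be a uniformizer. Every σ satisfies σπ ≡ π mod π², and since the residue
field is 𝔽_p, the pigeonhole principle gives ρ ≠ 1 with ρπ ≡ π mod π³. Choose H of order p avoiding
ρ, and let x be the H-norm of π, a uniformizer of the fixed field of H. Then ρ moves x so little
that the different of x has exponent at least 3p(p-1), measured in powers of π. But x has degree p
over ℚ, which caps this exponent at 2p² - p. Hence p ≤ 2. -/

open WithZero

/-! ### Values of rationals under a valuation with v(p) = exp(-n) -/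

section RationalValues

variable {E : Type*} [Field E] {v : Valuation E ℤᵐ⁰} {p n : ℕ}

theorem Valuation.map_intCast_le_one (v : Valuation E ℤᵐ⁰) (z : ℤ) : v (z : E) ≤ 1 := by
  have hnat (k : ℕ) : v (k : E) ≤ 1 := by
    induction k with
    | zero => simp
    | succ k ih =>
      rw [Nat.cast_succ]
      exact v.map_add_le ih (by simp)
  obtain ⟨k, rfl | rfl⟩ := z.eq_nat_or_neg
  · simpa using hnat k
  · simpa [Valuation.map_neg] using hnat k

theorem Valuation.map_intCast_eq_one_of_not_dvd (hp : p.Prime) (hvp : v (p : E) < 1) {z : ℤ}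
    (hz : ¬ (p : ℤ) ∣ z) : v (z : E) = 1 := by
  refine le_antisymm (v.map_intCast_le_one z) (le_of_not_gt fun h ↦ ?_)
  have hcop : IsCoprime (p : ℤ) z := (Nat.prime_iff_prime_int.mp hp).coprime_iff_not_dvd.mpr hz
  obtain ⟨a, b, hab⟩ := hcop
  have h1 : (a : E) * p + b * z = 1 := by exact_mod_cast congrArg (Int.cast (R := E)) hab
  have : v ((a : E) * p + b * z) < 1 := by
    refine v.map_add_lt ?_ ?_
    · rw [map_mul]; exact mul_lt_one_of_nonneg_of_lt_one_right (v.map_intCast_le_one a) zero_le hvp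
    · rw [map_mul]; exact mul_lt_one_of_nonneg_of_lt_one_right (v.map_intCast_le_one b) zero_le h
  simp [h1] at this

theorem exp_neg_natCast_lt_one (hn : n ≠ 0) : exp (-(n : ℤ)) < (1 : ℤᵐ⁰) := by
  rw [← exp_zero, exp_lt_exp]; omega

theorem Valuation.exists_map_intCast_eq_exp (hp : p.Prime) (hn : n ≠ 0)
    (hvp : v (p : E) = exp (-(n : ℤ))) {z : ℤ} (hz : z ≠ 0) :
    ∃ k : ℤ, v (z : E) = exp (n * k) := by
  obtain ⟨u, hu, h⟩ := (Int.finiteMultiplicity_iff.mpr ⟨by simpa using hp.ne_one, hz⟩ :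
    FiniteMultiplicity (p : ℤ) z).exists_eq_pow_mul_and_not_dvd
  refine ⟨-(multiplicity (p : ℤ) z : ℤ), ?_⟩
  conv_lhs => rw [hu]
  push_cast
  rw [map_mul, map_pow, hvp, v.map_intCast_eq_one_of_not_dvd hp
    (hvp.trans_lt (exp_neg_natCast_lt_one hn)) h, ← exp_nsmul]
  simp [mul_comm]

theorem Valuation.exists_map_ratCast_eq_exp [CharZero E] (hp : p.Prime) (hn : n ≠ 0)
    (hvp : v (p : E) = exp (-(n : ℤ))) {q : ℚ} (hq : q ≠ 0) :
    ∃ k : ℤ, v (q : E) = exp (n * k) := by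
  obtain ⟨a, ha⟩ := v.exists_map_intCast_eq_exp hp hn hvp (Rat.num_ne_zero.mpr hq)
  obtain ⟨b, hb⟩ := v.exists_map_intCast_eq_exp hp hn hvp (z := q.den) (by simp)
  refine ⟨a - b, ?_⟩
  rw [Rat.cast_def, map_div₀, ha]
  rw [Int.cast_natCast] at hb
  rw [hb, mul_sub, exp_sub]

theorem Valuation.exists_map_ratCast_sub_natCast_lt_one [CharZero E] (hp : p.Prime)
    (hvp : v (p : E) < 1) {q : ℚ} (hq : v (q : E) ≤ 1) :
    ∃ k < p, v ((q : E) - (k : ℕ)) < 1 := by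
  have hd0 : (q.den : E) ≠ 0 := by simp
  have hd : ¬ (p : ℤ) ∣ q.den := by
    intro hd
    have hnum : ¬ (p : ℤ) ∣ q.num := by
      intro hnum
      have := Nat.dvd_gcd (Int.natCast_dvd.mp hnum) (Int.natCast_dvd_natCast.mp hd)
      rw [q.reduced] at this
      exact hp.one_lt.ne' (Nat.dvd_one.mp this)
    have h1 := v.map_intCast_eq_one_of_not_dvd hp hvp hnum
    have h2 : v (q.den : E) < 1 := by
      obtain ⟨c, hc⟩ := hd
      have : (q.den : E) = p * c := by exact_mod_cast congrArg (Int.cast (R := E)) hc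
      rw [this, map_mul, mul_comm]
      exact mul_lt_one_of_nonneg_of_lt_one_right (v.map_intCast_le_one c) zero_le hvp
    have h3 : (q : E) * q.den = q.num := by
      rw [Rat.cast_def]; field_simp
    have h4 := congrArg v h3
    rw [map_mul, h1] at h4
    exact (mul_lt_one_of_nonneg_of_lt_one_right hq zero_le h2).ne h4
  have hcop : IsCoprime (p : ℤ) q.den := (Nat.prime_iff_prime_int.mp hp).coprime_iff_not_dvd.mpr hd
  obtain ⟨a, b, hab⟩ := hcop
  have hp0 : (p : ℤ) ≠ 0 := by exact_mod_cast hp.ne_zero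
  have hmod0 := Int.emod_nonneg (q.num * b) hp0
  have hmod1 := Int.emod_lt_of_pos (q.num * b) (by exact_mod_cast hp.pos : (0 : ℤ) < p)
  obtain ⟨k, hk⟩ := Int.eq_ofNat_of_zero_le hmod0
  refine ⟨k, by omega, ?_⟩
  have hdiv : (p : ℤ) ∣ q.num - k * q.den := by
    have h1 : q.num * b = p * (q.num * b / p) + k := by rw [← hk]; exact (Int.mul_ediv_add_emod _ _).symm
    refine ⟨q.num * a + (q.num * b / p) * q.den, ?_⟩
    linear_combination (-q.num) * hab + q.den * h1
  obtain ⟨c, hc⟩ := hdiv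
  have hc' : (q.num : E) - k * q.den = p * c := by exact_mod_cast congrArg (Int.cast (R := E)) hc
  have : ((q : E) - k) * q.den = p * c := by
    rw [← hc', Rat.cast_def]; field_simp
  have h5 := congrArg v this
  have h6 : v (q.den : E) = 1 := by
    simpa using v.map_intCast_eq_one_of_not_dvd hp hvp hd
  rw [map_mul, map_mul, h6, mul_one, mul_comm (v (p : E))] at h5
  rw [h5]
  exact mul_lt_one_of_nonneg_of_lt_one_right (v.map_intCast_le_one c) zero_le hvp

/-- Terms with pairwise different nonzero values do not cancel. -/
theorem Valuation.map_le_map_sum_of_injOn {ι : Type*} {s : Finset ι} {f : ι → E}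
    (hf : ∀ i ∈ s, ∀ j ∈ s, f i ≠ 0 → v (f i) = v (f j) → i = j) {i : ι} (hi : i ∈ s) :
    v (f i) ≤ v (∑ j ∈ s, f j) := by
  classical
  obtain ⟨j, hj, hmax⟩ := s.exists_max_image (fun j ↦ v (f j)) ⟨i, hi⟩
  rcases eq_or_ne (f j) 0 with h0 | h0
  · have := hmax i hi
    simp only [h0, map_zero, le_zero_iff] at this
    simp [this]
  · rw [v.map_sum_eq_of_lt hj fun k hk ↦ ?_]
    · exact hmax i hi
    · simp only [Finset.mem_sdiff, Finset.mem_singleton] at hk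
      exact lt_of_le_of_ne (hmax k hk.1) fun h ↦ hk.2 (hf j hj k hk.1 h0 h.symm).symm

/-- Nonzero rationals have exponents divisible by n = mk, while x ^ i shifts the exponent by -mi.
For i < k these shifts are distinct modulo n, so no two nonzero terms share a value. Used with m = 1
for a uniformizer and with m = k = p for a uniformizer of a subfield. -/
theorem Valuation.map_term_le_map_sum_pow [CharZero E] (hp : p.Prime) (hvp : v (p : E) = exp (-(n : ℤ)))
    {m k : ℕ} (hm : m ≠ 0) (hn : n = m * k) (hk : k ≠ 0) {x : E} (hx : v x = exp (-(m : ℤ)))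
    (a : ℕ → ℚ) {i : ℕ} (hi : i < k) :
    v ((a i : E) * x ^ i) ≤ v (∑ j ∈ Finset.range k, (a j : E) * x ^ j) := by
  have hn0 : n ≠ 0 := by rw [hn]; positivity
  refine v.map_le_map_sum_of_injOn (f := fun j ↦ (a j : E) * x ^ j) ?_ (Finset.mem_range.mpr hi)
  intro i hi j hj hi0 h
  have ha : a i ≠ 0 := by rintro h; simp [h] at hi0
  have hb : a j ≠ 0 := by
    rintro hb
    simp only [hb, Rat.cast_zero, zero_mul, map_zero, map_eq_zero] at h
    exact hi0 h
  obtain ⟨s, hs⟩ := v.exists_map_ratCast_eq_exp hp hn0 hvp ha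
  obtain ⟨t, ht⟩ := v.exists_map_ratCast_eq_exp hp hn0 hvp hb
  simp only [map_mul, map_pow, hs, ht, hx, ← exp_nsmul, ← exp_add, exp_inj, nsmul_eq_mul, hn] at h
  simp only [Finset.mem_range] at hi hj
  have hm' : (m : ℤ) ≠ 0 := by exact_mod_cast hm
  have h2 : (k : ℤ) * s - i = k * t - j := by
    apply mul_left_cancel₀ hm'
    push_cast at h
    linear_combination h
  have h3 : (k : ℤ) ∣ (i : ℤ) - j := ⟨s - t, by linear_combination -h2⟩
  have := Int.eq_zero_of_abs_lt_dvd h3 (by rw [abs_lt]; omega)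
  omega

end RationalValues

theorem WithZero.lt_exp_iff_le_exp_sub_one {x : ℤᵐ⁰} {a : ℤ} : x < exp a ↔ x ≤ exp (a - 1) := by
  induction x using WithZero.expRecOn with
  | zero => simp
  | exp b => rw [exp_lt_exp, exp_le_exp]; omega

/-! ### Expansions in a uniformizer and the action of the Galois group on it -/

section Uniformizer

variable {E : Type*} [Field E] [CharZero E] [Algebra ℚ E] [FiniteDimensional ℚ E]
  {v : Valuation E ℤᵐ⁰} {p n : ℕ} {π : E}

/-- Total ramification makes the exponent of p equal to the degree, so the n powers of π are
independent by non-cancellation and form a basis. -/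
theorem Valuation.exists_eq_sum_pow_uniformizer (hp : p.Prime) (hn : Module.finrank ℚ E = n)
    (hvp : v (p : E) = exp (-(n : ℤ))) (hπ : v π = exp (-1)) (x : E) :
    ∃ a : ℕ → ℚ, x = ∑ i ∈ Finset.range n, (a i : E) * π ^ i := by
  have hn0 : n ≠ 0 := by rw [← hn]; exact Module.finrank_pos.ne'
  have hli : LinearIndependent ℚ fun i : Fin n ↦ π ^ (i : ℕ) := by
    rw [Fintype.linearIndependent_iff]
    intro g hg i
    let a : ℕ → ℚ := fun j ↦ if h : j < n then g ⟨j, h⟩ else 0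
    have ha (j : Fin n) : a j = g j := by simp [a]
    have hsum : ∑ j ∈ Finset.range n, (a j : E) * π ^ j = 0 := by
      rw [← hg, Finset.sum_range]
      refine Finset.sum_congr rfl fun j _ ↦ ?_
      rw [ha, Algebra.smul_def, eq_ratCast]
    have h := v.map_term_le_map_sum_pow (m := 1) hp hvp one_ne_zero (by simp) hn0
      (by simpa using hπ) a i.2
    rw [hsum, map_zero, le_zero_iff, map_eq_zero, mul_eq_zero, ha] at h
    have hπ0 : π ≠ 0 := by rintro rfl; exact exp_ne_zero (hπ.symm.trans v.map_zero)
    simpa [hπ0] using h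
  have : Nonempty (Fin n) := ⟨⟨0, Nat.pos_of_ne_zero hn0⟩⟩
  let b := basisOfLinearIndependentOfCardEqFinrank hli (by simp [hn])
  refine ⟨fun j ↦ if h : j < n then b.repr x ⟨j, h⟩ else 0, ?_⟩
  conv_lhs => rw [← b.sum_repr x]
  rw [Finset.sum_range]
  refine Finset.sum_congr rfl fun j _ ↦ ?_
  simp [b, Algebra.smul_def]

theorem Valuation.exists_eq_sum_pow_uniformizer_of_le_one (hp : p.Prime)
    (hn : Module.finrank ℚ E = n) (hvp : v (p : E) = exp (-(n : ℤ))) (hπ : v π = exp (-1))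
    {x : E} (hx : v x ≤ 1) :
    ∃ a : ℕ → ℚ, x = ∑ i ∈ Finset.range n, (a i : E) * π ^ i ∧ ∀ i < n, v (a i : E) ≤ 1 := by
  have hn0 : n ≠ 0 := by rw [← hn]; exact Module.finrank_pos.ne'
  obtain ⟨a, ha⟩ := v.exists_eq_sum_pow_uniformizer hp hn hvp hπ x
  refine ⟨a, ha, fun i hi ↦ ?_⟩
  rcases eq_or_ne (a i) 0 with h0 | h0
  · simp [h0]
  have h := v.map_term_le_map_sum_pow (m := 1) hp hvp one_ne_zero (by simp) hn0
      (by simpa using hπ) a hi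
  rw [← ha] at h
  obtain ⟨s, hs⟩ := v.exists_map_ratCast_eq_exp hp hn0 hvp h0
  replace h := h.trans hx
  rw [map_mul, map_pow, hs, hπ, ← exp_nsmul, ← exp_add, ← exp_zero, exp_le_exp] at h
  rw [hs, ← exp_zero, exp_le_exp]
  -- The exponent ns - i is at most 0 with i < n, which rules out s ≥ 1.
  by_contra! hlt
  have hs1 : 0 < s := by
    by_contra! hs1
    exact hlt.not_ge (mul_nonpos_of_nonneg_of_nonpos (by positivity) hs1)
  have : (n : ℤ) ≤ n * s := le_mul_of_one_le_right (by positivity) hs1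
  simp only [smul_neg, nsmul_eq_mul, mul_one] at h
  omega

/-- The residue field is 𝔽_p: modulo π only the rational constant term of the expansion survives. -/
theorem Valuation.exists_sub_natCast_lt_one (hp : p.Prime)
    (hn : Module.finrank ℚ E = n) (hvp : v (p : E) = exp (-(n : ℤ))) (hπ : v π = exp (-1))
    {x : E} (hx : v x ≤ 1) : ∃ k < p, v (x - (k : ℕ)) < 1 := by
  have hn0 : n ≠ 0 := by rw [← hn]; exact Module.finrank_pos.ne'
  obtain ⟨a, ha, hle⟩ := v.exists_eq_sum_pow_uniformizer_of_le_one hp hn hvp hπ hx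
  obtain ⟨k, hk, hak⟩ := v.exists_map_ratCast_sub_natCast_lt_one hp
    (hvp.trans_lt (exp_neg_natCast_lt_one hn0)) (hle 0 (Nat.pos_of_ne_zero hn0))
  refine ⟨k, hk, ?_⟩
  obtain ⟨m, rfl⟩ := Nat.exists_eq_succ_of_ne_zero hn0
  rw [Finset.sum_range_succ', pow_zero, mul_one] at ha
  have : x - k = (∑ i ∈ Finset.range m, (a (i + 1) : E) * π ^ (i + 1)) + ((a 0 : E) - k) := by
    rw [ha]; ring
  rw [this]
  refine v.map_add_lt (v.map_sum_lt one_ne_zero fun i hi ↦ ?_) hak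
  rw [map_mul, map_pow, mul_comm]
  refine (mul_le_of_le_one_right' (hle _ (by simpa using hi))).trans_lt ?_
  refine pow_lt_one₀ zero_le ?_ (by simp)
  rw [hπ]
  exact exp_neg_natCast_lt_one (n := 1) one_ne_zero

theorem Valuation.exists_sub_natCast_mul_pow_le (hp : p.Prime)
    (hn : Module.finrank ℚ E = n) (hvp : v (p : E) = exp (-(n : ℤ))) (hπ : v π = exp (-1))
    {x : E} {i : ℕ} (hx : v x ≤ exp (-(i : ℤ))) :
    ∃ k < p, v (x - (k : ℕ) * π ^ i) ≤ exp (-((i + 1 : ℕ) : ℤ)) := by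
  have hπ0 : π ≠ 0 := by rintro rfl; exact exp_ne_zero (hπ.symm.trans v.map_zero)
  have hπi : v (π ^ i) = exp (-(i : ℤ)) := by rw [map_pow, hπ, ← exp_nsmul]; simp
  have hx' : v (x / π ^ i) ≤ 1 := by
    rw [map_div₀, hπi]; exact div_le_one_of_le₀ hx zero_le
  obtain ⟨k, hk, h⟩ := v.exists_sub_natCast_lt_one hp hn hvp hπ hx'
  refine ⟨k, hk, ?_⟩
  rw [← exp_zero, lt_exp_iff_le_exp_sub_one] at h
  have : x - k * π ^ i = (x / π ^ i - k) * π ^ i := by field_simp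
  rw [this, map_mul, hπi]
  refine (mul_le_mul_left h _).trans ?_
  rw [← exp_add, exp_le_exp]
  push_cast; omega

/-- The action on a totally ramified uniformizer is wild if the group has exponent `p`. -/
theorem Valuation.map_aut_sub_le_of_pow_eq_one (hp : p.Prime)
    (hn : Module.finrank ℚ E = n) (hvp : v (p : E) = exp (-(n : ℤ))) (hπ : v π = exp (-1))
    (hv : ∀ (σ : Gal(E/ℚ)) (x : E), v (σ x) = v x) {σ : Gal(E/ℚ)} (hσ : σ ^ p = 1) :
    v (σ π - π) ≤ exp (-2) := by
  have hn0 : n ≠ 0 := by rw [← hn]; exact Module.finrank_pos.ne'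
  have hp1 : v (p : E) < 1 := hvp.trans_lt (exp_neg_natCast_lt_one hn0)
  obtain ⟨k, -, hk⟩ := v.exists_sub_natCast_mul_pow_le (i := 1) hp hn hvp hπ (x := σ π)
    (by rw [hv, hπ]; simp)
  simp only [pow_one, Nat.reduceAdd, Nat.cast_ofNat] at hk
  -- Modulo π², σ multiplies π by k, so σ ^ p = 1 forces k ^ p ≡ 1 mod p, and k ≡ 1 by Fermat.
  have hpow (j : ℕ) : v ((σ ^ j) π - (k : E) ^ j * π) ≤ exp (-2) := by
    induction j with
    | zero => simp
    | succ j ih =>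
      have : (σ ^ (j + 1)) π - (k : E) ^ (j + 1) * π =
          σ ((σ ^ j) π - (k : E) ^ j * π) + (k : E) ^ j * (σ π - k * π) := by
        rw [_root_.map_sub, map_mul, map_pow, map_natCast, pow_succ' σ, AlgEquiv.mul_apply]; ring
      rw [this]
      refine v.map_add_le (by rwa [hv]) ?_
      rw [map_mul]
      refine (mul_le_of_le_one_left' ?_).trans hk
      simpa using v.map_intCast_le_one ((k : ℤ) ^ j)
  have h1 := hpow p
  rw [hσ, AlgEquiv.one_apply] at h1
  have h2 : v (((1 - (k : ℤ) ^ p : ℤ) : E) * π) ≤ exp (-2) := by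
    convert h1 using 2; push_cast; ring
  have h3 : (p : ℤ) ∣ 1 - (k : ℤ) ^ p := by
    by_contra h
    rw [map_mul, v.map_intCast_eq_one_of_not_dvd hp hp1 h, one_mul, hπ, exp_le_exp] at h2
    omega
  have h4 : (p : ℤ) ∣ k - 1 := by
    have : Fact p.Prime := ⟨hp⟩
    rw [← ZMod.intCast_zmod_eq_zero_iff_dvd] at h3
    rw [← ZMod.intCast_zmod_eq_zero_iff_dvd]
    push_cast at h3 ⊢
    rw [ZMod.pow_card] at h3
    linear_combination -h3
  obtain ⟨c, hc⟩ := h4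
  have hc' : (k : E) - 1 = p * c := by exact_mod_cast congrArg (Int.cast (R := E)) hc
  have : σ π - π = (σ π - k * π) + p * c * π := by linear_combination hc' * π
  rw [this]
  refine v.map_add_le hk ?_
  rw [map_mul, map_mul, hπ]
  calc v p * v c * exp (-1) ≤ exp (-1) * 1 * exp (-1) := by
        gcongr
        · rw [hvp, exp_le_exp]; omega
        · exact v.map_intCast_le_one c
    _ = exp (-2) := by rw [mul_one, ← exp_add]; rfl

/-- Pigeonhole on the coefficient of π² in σπ - π, which takes only p values: if σ and τ share it,
then σ⁻¹τ works, because σ preserves v. -/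
theorem Valuation.exists_ne_one_map_aut_sub_le (hp : p.Prime)
    (hn : Module.finrank ℚ E = n) (hvp : v (p : E) = exp (-(n : ℤ))) (hπ : v π = exp (-1))
    (hv : ∀ (σ : Gal(E/ℚ)) (x : E), v (σ x) = v x) (hexp : ∀ σ : Gal(E/ℚ), σ ^ p = 1)
    (hcard : p < Nat.card Gal(E/ℚ)) :
    ∃ ρ : Gal(E/ℚ), ρ ≠ 1 ∧ v (ρ π - π) ≤ exp (-3) := by
  have hex (σ : Gal(E/ℚ)) : ∃ k < p, v (σ π - π - (k : ℕ) * π ^ 2) ≤ exp (-3) := by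
    simpa using v.exists_sub_natCast_mul_pow_le (i := 2) hp hn hvp hπ
      (by simpa using v.map_aut_sub_le_of_pow_eq_one hp hn hvp hπ hv (hexp σ))
  choose k hk hle using hex
  have : Fintype Gal(E/ℚ) := Fintype.ofFinite _
  obtain ⟨σ, -, τ, -, hne, h⟩ := Finset.exists_ne_map_eq_of_card_lt_of_maps_to
    (s := (Finset.univ : Finset Gal(E/ℚ))) (t := Finset.range p) (f := k)
    (by simpa [Nat.card_eq_fintype_card] using hcard) (by intro σ _; simpa using hk σ)
  refine ⟨σ⁻¹ * τ, fun h1 ↦ hne (inv_mul_eq_one.mp h1), ?_⟩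
  rw [← hv σ, _root_.map_sub, AlgEquiv.mul_apply, ← AlgEquiv.mul_apply σ, mul_inv_cancel,
    AlgEquiv.one_apply]
  have : τ π - σ π = (τ π - π - k τ * π ^ 2) - (σ π - π - k σ * π ^ 2) := by rw [h]; ring
  rw [this]
  exact v.map_sub_le (hle τ) (hle σ)

end Uniformizer

open Polynomial in
-- Over the valuation ring, q is divisible by the product of the X - r i, and the cofactor takes an
-- integral value at x.
theorem Valuation.map_eval_le_prod_map_sub {E ι : Type*} [Field E] {v : Valuation E ℤᵐ⁰}
    {q : E[X]} (hq : ∀ i, v (q.coeff i) ≤ 1) (s : Finset ι) {r : ι → E} (hr : Set.InjOn r s)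
    (hr1 : ∀ i ∈ s, v (r i) ≤ 1) (hroot : ∀ i ∈ s, q.eval (r i) = 0) {x : E} (hx : v x ≤ 1) :
    v (q.eval x) ≤ ∏ i ∈ s, v (x - r i) := by
  classical
  rcases eq_or_ne q 0 with rfl | hq0
  · simp
  have hmem : q ∈ lifts v.integer.subtype := by
    rw [lifts_iff_coeff_lifts]
    exact fun i ↦ ⟨⟨q.coeff i, hq i⟩, rfl⟩
  obtain ⟨Q, rfl⟩ := (mem_lifts _).mp hmem
  have hQ0 : Q ≠ 0 := by rintro rfl; simp at hq0
  have heval (y : v.integer) : ((Q.eval y : v.integer) : E) = (Q.map v.integer.subtype).eval (y : E) :=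
    (eval_map_apply (f := v.integer.subtype) (p := Q) y).symm
  let R : s → v.integer := fun i ↦ ⟨r i, hr1 i i.2⟩
  have hR : Function.Injective R := fun i j h ↦
    Subtype.ext (hr i.2 j.2 (congrArg Subtype.val h))
  have hdvd : ((s.attach.val.map R).map fun a ↦ X - C a).prod ∣ Q := by
    rw [Multiset.prod_X_sub_C_dvd_iff_le_roots hQ0,
      Multiset.le_iff_subset (s.attach.nodup.map hR)]
    intro y hy
    obtain ⟨i, -, rfl⟩ := Multiset.mem_map.mp hy
    rw [mem_roots hQ0, IsRoot, ← Subtype.coe_inj, heval]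
    exact hroot i i.2
  obtain ⟨K, hK⟩ := hdvd
  have hval := heval ⟨x, hx⟩
  rw [← hval, hK, eval_mul]
  push_cast
  rw [map_mul]
  refine (mul_le_of_le_one_right' (K.eval _).2).trans (le_of_eq ?_)
  rw [Multiset.map_map, show (s.attach.val.map ((fun a ↦ X - C a) ∘ R)).prod =
    ∏ i ∈ s.attach, (X - C (R i)) from rfl, eval_prod]
  push_cast
  rw [map_prod, ← s.prod_attach]
  simp [R]

section TotallyRamified

variable {E : Type*} [Field E] [CharZero E] [Algebra ℚ E] [FiniteDimensional ℚ E]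
  {v : Valuation E ℤᵐ⁰} {p n : ℕ} {π : E}

theorem Valuation.injective_aut_apply_uniformizer (hp : p.Prime) (hn : Module.finrank ℚ E = n)
    (hvp : v (p : E) = exp (-(n : ℤ))) (hπ : v π = exp (-1)) :
    Function.Injective fun σ : Gal(E/ℚ) ↦ σ π := by
  intro σ τ h
  ext x
  obtain ⟨a, rfl⟩ := v.exists_eq_sum_pow_uniformizer hp hn hvp hπ x
  simp only at h
  simp [h]

/-- An elementary form of the behaviour of ramification in quotients: an integral element `x` of
the fixed field of `H` moves under `σ` by at most the product over `τ ∈ H` of the displacements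
between `σ π` and `τ π`. -/
theorem Valuation.map_aut_sub_le_prod (hp : p.Prime) (hn : Module.finrank ℚ E = n)
    (hvp : v (p : E) = exp (-(n : ℤ))) (hπ : v π = exp (-1))
    (hv : ∀ (σ : Gal(E/ℚ)) (x : E), v (σ x) = v x) (H : Subgroup Gal(E/ℚ)) [Fintype H]
    {x : E} (hx : v x ≤ 1) (hH : ∀ τ ∈ H, τ x = x) (σ : Gal(E/ℚ)) :
    v (σ x - x) ≤ ∏ τ : H, v (σ π - (τ : Gal(E/ℚ)) π) := by
  obtain ⟨a, ha, hle⟩ := v.exists_eq_sum_pow_uniformizer_of_le_one hp hn hvp hπ hx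
  have hπ1 : v π ≤ 1 := by rw [hπ, ← exp_zero, exp_le_exp]; omega
  -- This polynomial vanishes at τπ for τ ∈ H, since τ fixes x, and takes the value σx - x at σπ.
  let q : Polynomial E := (∑ i ∈ Finset.range n, .C (a i : E) * .X ^ i) - .C x
  have heval (τ : Gal(E/ℚ)) : q.eval (τ π) = τ x - x := by
    have : τ x = ∑ i ∈ Finset.range n, (a i : E) * (τ π) ^ i := by conv_lhs => rw [ha]; simp
    simp [q, Polynomial.eval_finsetSum, this]
  rw [← heval]
  refine v.map_eval_le_prod_map_sub (fun i ↦ ?_) Finset.univ ?_ ?_ ?_ (by rwa [hv])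
  · rw [Polynomial.coeff_sub, Polynomial.finsetSum_coeff]
    refine v.map_sub_le (v.map_sum_le fun j hj ↦ ?_) ?_
    · rw [Polynomial.coeff_C_mul_X_pow]
      split_ifs
      · exact hle j (by simpa using hj)
      · simp
    · rw [Polynomial.coeff_C]
      split_ifs
      · exact hx
      · simp
  · exact fun τ _ τ' _ h ↦ Subtype.ext (v.injective_aut_apply_uniformizer hp hn hvp hπ h)
  · exact fun τ _ ↦ by rwa [hv]
  · exact fun τ _ ↦ by rw [heval, hH τ τ.2, sub_self]

end TotallyRamified

/-! ### Bounding the different from above -/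

section Eisenstein

variable {E : Type*} [Field E] [CharZero E] {v : Valuation E ℤᵐ⁰} {p : ℕ}

open Polynomial in
/-- Lower bound for the different of an element of value `p` all of whose conjugates are
`x, g 1, …, g (p - 1)`. -/
theorem Valuation.le_prod_map_sub_conjugates (hp : p.Prime)
    (hvp : v (p : E) = exp (-((p ^ 2 : ℕ) : ℤ))) {g : ℕ → E} (hg : v (g 0) = exp (-(p : ℤ)))
    (hrat : ∏ i ∈ Finset.range p, (X - C (g i)) ∈ lifts (Rat.castHom E)) :
    exp (-(2 * p ^ 2 - p : ℤ)) ≤ ∏ i ∈ Finset.Ico 1 p, v (g 0 - g i) := by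
  have hmonic : (∏ i ∈ Finset.range p, (X - C (g i))).Monic :=
    monic_prod_of_monic _ _ fun i _ ↦ monic_X_sub_C _
  have hdeg : (∏ i ∈ Finset.range p, (X - C (g i))).natDegree = p := by
    rw [natDegree_prod_of_monic _ _ fun i _ ↦ monic_X_sub_C _]; simp
  obtain ⟨f, hf, hfdeg, hfmonic⟩ := lifts_and_natDegree_eq_and_monic hrat hmonic
  rw [hdeg] at hfdeg
  have hder : (derivative (f.map (Rat.castHom E))).eval (g 0) =
      ∏ i ∈ Finset.Ico 1 p, (g 0 - g i) := by
    rw [hf, Finset.prod_range_eq_mul_Ico _ hp.pos]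
    simp [derivative_mul, eval_prod]
  have hsum : (derivative (f.map (Rat.castHom E))).eval (g 0) =
      ∑ j ∈ Finset.range p, (((derivative f).coeff j : ℚ) : E) * (g 0) ^ j := by
    rw [derivative_map, eval_map, eval₂_eq_sum_range' _ (n := p)]
    · simp
    · rw [← hfdeg]
      exact natDegree_derivative_lt (by rw [hfdeg]; exact hp.ne_zero)
  -- The derivative at g 0 is at least as large as its top term p · (g 0) ^ (p - 1), whose exponent
  -- is -(p² + p(p - 1)).
  have h := v.map_term_le_map_sum_pow (m := p) hp hvp hp.ne_zero (by ring) hp.ne_zero hg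
    (derivative f).coeff (Nat.sub_lt hp.pos one_pos)
  rw [← hsum, hder, map_prod] at h
  refine le_trans (le_of_eq ?_) h
  have h1 : p - 1 + 1 = p := Nat.sub_add_cancel hp.one_le
  have h2 : f.coeff p = 1 := by rw [← hfdeg]; exact hfmonic
  rw [coeff_derivative, h1, h2, one_mul, map_mul, map_pow, hg, ← exp_nsmul]
  have h3 : (((p - 1 : ℕ) + 1 : ℚ) : E) = p := by
    have : ((p - 1 : ℕ) + 1 : ℚ) = p := by exact_mod_cast h1
    rw [this]; simp
  rw [h3, hvp, ← exp_add, exp_inj]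
  have : ((p - 1 : ℕ) : ℤ) = p - 1 := by omega
  rw [nsmul_eq_mul, this]
  push_cast
  ring

end Eisenstein

/-! ### Groups of order p² and exponent p -/

section ElementaryAbelian

theorem Subgroup.eq_top_of_le_of_card_eq_prime_of_mem {G : Type*} [Group G] [Finite G] {p : ℕ}
    (hp : p.Prime) (hG : Nat.card G = p ^ 2) {H S : Subgroup G} (hH : Nat.card H = p) (hHS : H ≤ S)
    {g : G} (hg : g ∉ H) (hgS : g ∈ S) : S = ⊤ := by
  obtain ⟨k, hk, hS⟩ := (Nat.dvd_prime_pow hp).mp (hG ▸ S.card_subgroup_dvd_card)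
  have hlt : Nat.card H < Nat.card S := by
    by_contra! h
    exact hg (Subgroup.eq_of_le_of_card_ge hHS h ▸ hgS)
  rw [hH, hS] at hlt
  have hk2 : k = 2 := by
    have : 1 < k := by
      rw [← Nat.pow_lt_pow_iff_right hp.one_lt]; simpa using hlt
    omega
  exact Subgroup.eq_top_of_card_eq S (by rw [hS, hG, hk2])

/-- In an elementary abelian group of order `p ^ 2`, every element avoids some subgroup of
order `p`. -/
theorem Subgroup.exists_card_eq_prime_notMem {G : Type*} [Group G] [Finite G] {p : ℕ}
    (hp : p.Prime) (hG : Nat.card G = p ^ 2) (hexp : ∀ g : G, g ^ p = 1) {g : G} (hg : g ≠ 1) :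
    ∃ H : Subgroup G, Nat.card H = p ∧ g ∉ H := by
  have : Fact p.Prime := ⟨hp⟩
  have hcard {x : G} (hx : x ≠ 1) : Nat.card (Subgroup.zpowers x) = p := by
    rw [Nat.card_zpowers]; exact orderOf_eq_prime (hexp x) hx
  obtain ⟨t, ht⟩ : ∃ t, t ∉ Subgroup.zpowers g := by
    by_contra! h
    have := hcard hg
    rw [(Subgroup.eq_top_iff' _).mpr h, Subgroup.card_top, hG] at this
    exact absurd this (by rw [sq]; exact (Nat.lt_mul_self_iff.mpr hp.one_lt).ne')
  have ht1 : t ≠ 1 := by rintro rfl; exact ht (one_mem _)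
  refine ⟨Subgroup.zpowers t, hcard ht1, fun hgt ↦ ht ?_⟩
  have := Subgroup.eq_of_le_of_card_ge (Subgroup.zpowers_le.mpr hgt) (by rw [hcard hg, hcard ht1])
  rw [this]
  exact Subgroup.mem_zpowers t

theorem apply_prod_range_pow {E M : Type*} [Monoid M] [CommMonoid E] {f : M → E} {g : M} {p : ℕ}
    (hg : g ^ p = 1) :
    ∏ i ∈ Finset.range p, f (g * g ^ i) = ∏ i ∈ Finset.range p, f (g ^ i) := by
  rcases p with - | p
  · simp
  · rw [Finset.prod_range_succ, Finset.prod_range_succ', ← pow_succ', hg, pow_zero]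
    simp_rw [← pow_succ']

/-- A subgroup of order p in a group of order p² is maximal, so H and ρ generate the Galois group.
-/
theorem exists_ratCast_eq_of_forall_mem_of_apply_eq {E : Type*} [Field E] [Algebra ℚ E]
    [FiniteDimensional ℚ E] [IsGalois ℚ E] {p : ℕ} (hp : p.Prime)
    (hn : Module.finrank ℚ E = p ^ 2) {H : Subgroup Gal(E/ℚ)} (hH : Nat.card H = p)
    {ρ : Gal(E/ℚ)} (hρ : ρ ∉ H) {z : E} (hz : ∀ τ ∈ H, τ z = z) (hρz : ρ z = z) :
    ∃ q : ℚ, (q : E) = z := by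
  have htop : MulAction.stabilizer Gal(E/ℚ) z = ⊤ :=
    Subgroup.eq_top_of_le_of_card_eq_prime_of_mem hp (by rw [IsGalois.card_aut_eq_finrank, hn]) hH
      (fun τ hτ ↦ hz τ hτ) hρ hρz
  obtain ⟨q, hq⟩ := (IsGalois.mem_range_algebraMap_iff_fixed (F := ℚ) z).mpr fun σ ↦
    (htop ▸ Subgroup.mem_top σ : σ ∈ MulAction.stabilizer Gal(E/ℚ) z)
  exact ⟨q, by rw [← hq, eq_ratCast]⟩

end ElementaryAbelian

/-! ### The local contradiction in degree p² -/

section TotallyRamified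

variable {E : Type*} [Field E] [CharZero E] [Algebra ℚ E] [FiniteDimensional ℚ E]
  {v : Valuation E ℤᵐ⁰} {p : ℕ} {π : E}

/-- The product of the ρ ^ i z is the norm of z down to ℚ. Its exponent is p times that of z, and it
is divisible by p² because the norm is rational. -/
theorem Valuation.exists_eq_exp_of_forall_mem_apply_eq [IsGalois ℚ E] (hp : p.Prime)
    (hn : Module.finrank ℚ E = p ^ 2) (hvp : v (p : E) = exp (-((p ^ 2 : ℕ) : ℤ)))
    (hv : ∀ (σ : Gal(E/ℚ)) (x : E), v (σ x) = v x) (hexp : ∀ σ : Gal(E/ℚ), σ ^ p = 1)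
    (hcomm : ∀ σ τ : Gal(E/ℚ), σ * τ = τ * σ) {H : Subgroup Gal(E/ℚ)} (hH : Nat.card H = p)
    {ρ : Gal(E/ℚ)} (hρ : ρ ∉ H) {z : E} (hz : ∀ τ ∈ H, τ z = z) (hz0 : z ≠ 0) :
    ∃ k : ℤ, v z = exp (p * k) := by
  obtain ⟨q, hq⟩ := exists_ratCast_eq_of_forall_mem_of_apply_eq hp hn hH hρ
    (z := ∏ i ∈ Finset.range p, (ρ ^ i) z) (fun τ hτ ↦ by
      rw [map_prod]
      refine Finset.prod_congr rfl fun i _ ↦ ?_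
      rw [← AlgEquiv.mul_apply, hcomm, AlgEquiv.mul_apply, hz τ hτ])
    (by
      rw [map_prod]
      exact apply_prod_range_pow (f := fun σ : Gal(E/ℚ) ↦ σ z) (hexp ρ))
  have hval : v (q : E) = v z ^ p := by
    rw [hq, map_prod, Finset.prod_congr rfl fun i _ ↦ hv (ρ ^ i) z]; simp
  have hq0 : q ≠ 0 := by
    rintro rfl
    rw [Rat.cast_zero, map_zero] at hval
    exact hz0 (v.zero_iff.mp (pow_eq_zero_iff hp.ne_zero |>.mp hval.symm))
  obtain ⟨k, hk⟩ := v.exists_map_ratCast_eq_exp hp (pow_ne_zero 2 hp.ne_zero) hvp hq0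
  refine ⟨k, ?_⟩
  have hvz : v z ≠ 0 := by simpa using hz0
  obtain ⟨m, hm⟩ : ∃ m : ℤ, v z = exp m := ⟨_, (exp_log hvz).symm⟩
  rw [hval, hm, ← exp_nsmul, exp_inj] at hk
  rw [hm, exp_inj]
  have hp0 : (p : ℤ) ≠ 0 := by exact_mod_cast hp.ne_zero
  apply mul_left_cancel₀ hp0
  push_cast at hk
  rw [nsmul_eq_mul] at hk
  linear_combination hk

/-- There is no totally ramified elementary abelian extension of degree `p ^ 2` of `ℚ` at an odd
prime `p`. -/
theorem Valuation.false_of_totallyRamified_of_finrank_eq_sq [IsGalois ℚ E] (hp : p.Prime)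
    (hp2 : p ≠ 2) (hn : Module.finrank ℚ E = p ^ 2) (hvp : v (p : E) = exp (-((p ^ 2 : ℕ) : ℤ)))
    (hπ : v π = exp (-1))
    (hv : ∀ (σ : Gal(E/ℚ)) (x : E), v (σ x) = v x) (hexp : ∀ σ : Gal(E/ℚ), σ ^ p = 1)
    (hcomm : ∀ σ τ : Gal(E/ℚ), σ * τ = τ * σ) : False := by
  classical
  have hG : Nat.card Gal(E/ℚ) = p ^ 2 := by rw [IsGalois.card_aut_eq_finrank, hn]
  obtain ⟨ρ, hρ1, hρ3⟩ := v.exists_ne_one_map_aut_sub_le hp hn hvp hπ hv hexp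
    (by rw [hG, sq]; exact Nat.lt_mul_self_iff.mpr hp.one_lt)
  obtain ⟨H, hH, hρ⟩ := Subgroup.exists_card_eq_prime_notMem hp hG hexp hρ1
  have : Fintype H := Fintype.ofFinite H
  have hHcard : Fintype.card H = p := by rw [← Nat.card_eq_fintype_card, hH]
  set x : E := ∏ τ : H, (τ : Gal(E/ℚ)) π with hx
  have hvx : v x = exp (-(p : ℤ)) := by
    rw [hx, map_prod]
    simp [hv, hπ, hHcard, ← exp_nsmul]
  have hfix : ∀ τ ∈ H, τ x = x := by
    intro τ hτ
    rw [hx, map_prod]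
    exact Fintype.prod_equiv (Equiv.mulLeft (⟨τ, hτ⟩ : H)) _ _ fun _ ↦ rfl
  have hx1 : v x ≤ 1 := by rw [hvx, ← exp_zero, exp_le_exp]; omega
  -- The factor τ = 1 contributes exponent -3, and the other p - 1 factors at most -2 each.
  have hbound : v (ρ x - x) ≤ exp (-(2 * p + 1 : ℤ)) := by
    refine (v.map_aut_sub_le_prod hp hn hvp hπ hv H hx1 hfix ρ).trans ?_
    rw [← Finset.mul_prod_erase _ _ (Finset.mem_univ (1 : H))]
    have h2 (τ : H) : v (ρ π - (τ : Gal(E/ℚ)) π) ≤ exp (-2) := by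
      have : ρ π - (τ : Gal(E/ℚ)) π = (ρ π - π) - ((τ : Gal(E/ℚ)) π - π) := by ring
      rw [this]
      exact v.map_sub_le (v.map_aut_sub_le_of_pow_eq_one hp hn hvp hπ hv (hexp _))
        (v.map_aut_sub_le_of_pow_eq_one hp hn hvp hπ hv (hexp _))
    calc _ ≤ exp (-3) * ∏ _τ ∈ Finset.univ.erase (1 : H), exp (-2 : ℤ) := by
          gcongr with τ
          · simpa using hρ3
          · simp
          · exact h2 _
      _ = exp (-(2 * p + 1 : ℤ)) := by
          rw [Finset.prod_const, Finset.card_erase_of_mem (Finset.mem_univ _), Finset.card_univ,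
            hHcard, ← exp_nsmul, ← exp_add, exp_inj, nsmul_eq_mul,
            Nat.cast_sub hp.one_le]
          push_cast; ring
  -- ρx - x lies in the fixed field of H, so its exponent is a multiple of p; being at most -(2p +
  -- 1), it is at most -3p.
  have hbound3 : v (ρ x - x) ≤ exp (-(3 * p : ℤ)) := by
    rcases eq_or_ne (ρ x - x) 0 with h0 | h0
    · simp [h0]
    obtain ⟨k, hk⟩ := v.exists_eq_exp_of_forall_mem_apply_eq hp hn hvp hv hexp hcomm hH hρ
      (z := ρ x - x) (fun τ hτ ↦ by
        rw [_root_.map_sub, hfix τ hτ, ← AlgEquiv.mul_apply, hcomm, AlgEquiv.mul_apply, hfix τ hτ]) h0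
    rw [hk, exp_le_exp] at hbound ⊢
    have hp0 : (0 : ℤ) < p := by exact_mod_cast hp.pos
    have hk3 : k ≤ -3 := by
      by_contra! h
      nlinarith
    nlinarith
  have hpow (i : ℕ) : v (x - (ρ ^ i) x) ≤ exp (-(3 * p : ℤ)) := by
    induction i with
    | zero => simp
    | succ i ih =>
      have : x - (ρ ^ (i + 1)) x = (x - (ρ ^ i) x) - (ρ ^ i) (ρ x - x) := by
        rw [_root_.map_sub, pow_succ, AlgEquiv.mul_apply]; ring
      rw [this]
      exact v.map_sub_le ih (by rwa [hv])
  have hlow := v.le_prod_map_sub_conjugates hp hvp (g := fun i ↦ (ρ ^ i) x) (by simpa using hvx) ?_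
  · replace hlow := hlow.trans (Finset.prod_le_prod' fun i _ ↦ by
      simpa only [pow_zero, AlgEquiv.one_apply] using hpow i)
    rw [Finset.prod_const, Nat.card_Ico, ← exp_nsmul, exp_le_exp, nsmul_eq_mul,
      Nat.cast_sub hp.one_le] at hlow
    have hp3 : (3 : ℤ) ≤ p := by
      have := hp.two_le
      omega
    push_cast at hlow
    -- The two bounds give 3p(p - 1) ≤ 2p² - p, that is p ≤ 2.
    nlinarith
  -- H fixes each factor and ρ permutes the factors cyclically, so the coefficients are rational.
  · rw [Polynomial.lifts_iff_coeff_lifts]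
    intro m
    have key (σ : Gal(E/ℚ))
        (h : ∏ i ∈ Finset.range p, (Polynomial.X - Polynomial.C (σ ((ρ ^ i) x))) =
          ∏ i ∈ Finset.range p, (Polynomial.X - Polynomial.C ((ρ ^ i) x))) :
        σ ((∏ i ∈ Finset.range p, (Polynomial.X - Polynomial.C ((ρ ^ i) x))).coeff m) =
          (∏ i ∈ Finset.range p, (Polynomial.X - Polynomial.C ((ρ ^ i) x))).coeff m := by
      conv_rhs => rw [← h]
      have := Polynomial.coeff_map (p := ∏ i ∈ Finset.range p,
        (Polynomial.X - Polynomial.C ((ρ ^ i) x))) (σ : E →+* E) m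
      rw [Polynomial.map_prod] at this
      simpa using this.symm
    refine exists_ratCast_eq_of_forall_mem_of_apply_eq hp hn hH hρ (fun τ hτ ↦ key τ ?_) (key ρ ?_)
    · refine Finset.prod_congr rfl fun i _ ↦ ?_
      rw [← AlgEquiv.mul_apply, hcomm, AlgEquiv.mul_apply, hfix τ hτ]
    · exact apply_prod_range_pow (f := fun σ : Gal(E/ℚ) ↦ Polynomial.X - Polynomial.C (σ x)) (hexp ρ)

end TotallyRamified

/-! ### Inertia groups and Minkowski's theorem -/

section Inertia

open Algebra

theorem Algebra.IsUnramifiedIn.of_tower {F E : Type*} [Field F] [Field E] [NumberField F]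
    [NumberField E] [Algebra F E] {I : Ideal ℤ} (h : IsUnramifiedIn (𝓞 E) I) :
    IsUnramifiedIn (𝓞 F) I := by
  intro P hP hPI
  obtain ⟨⟨Q, hQ, hQP⟩⟩ := P.nonempty_primesOver (S := 𝓞 E)
  have : Q.LiesOver I := .trans Q P I
  have := h Q hQ this
  exact IsUnramifiedAt.of_liesOver ℤ P Q

variable {E : Type*} [Field E] [NumberField E] [IsGalois ℚ E] {q : ℕ}

theorem Ideal.card_inertia_gal_eq_ramificationIdx [Fact q.Prime] (Q : Ideal (𝓞 E)) [Q.IsPrime]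
    [hQ : Q.LiesOver (span {(q : ℤ)})] :
    Nat.card (Q.inertia Gal(E/ℚ)) = Q.ramificationIdx ℤ := by
  have hmax : (span {(q : ℤ)}).IsMaximal := Int.ideal_span_isMaximal_of_prime q
  have : Finite (ℤ ⧸ span {(q : ℤ)}) := Ring.HasFiniteQuotients.finiteQuotient
    (by simpa using (Fact.out : q.Prime).ne_zero)
  rw [card_inertia_eq_ramificationIdxIn (span {(q : ℤ)}) Q,
    ramificationIdxIn_eq_ramificationIdx (span {(q : ℤ)}) Q Gal(E/ℚ)]

theorem Ideal.inertia_gal_eq_bot_iff [Fact q.Prime] (Q : Ideal (𝓞 E)) [Q.IsPrime]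
    [hQ : Q.LiesOver (span {(q : ℤ)})] :
    Q.inertia Gal(E/ℚ) = ⊥ ↔ IsUnramifiedAt ℤ Q := by
  rw [← ramificationIdx_eq_one_iff, ← card_inertia_gal_eq_ramificationIdx (q := q),
    Subgroup.card_eq_one]

/-- The inertia group over D is the whole group of E over D, so the step from D to E already
accounts for the full ramification index of P, leaving 1 below. -/
theorem Ideal.isUnramifiedAt_under_of_isGaloisGroup_inertia {D : Type*} [Field D] [NumberField D]
    [Algebra D E] [Fact q.Prime] (P : Ideal (𝓞 E)) [P.IsPrime] [hP : P.LiesOver (span {(q : ℤ)})]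
    [IsGaloisGroup (P.inertia Gal(E/ℚ)) D E] : IsUnramifiedAt ℤ (P.under (𝓞 D)) := by
  have hmaxq : (span {(q : ℤ)}).IsMaximal := Int.ideal_span_isMaximal_of_prime q
  have h𝔭 : (P.under (𝓞 D)).LiesOver (span {(q : ℤ)}) := ⟨by rw [under_under]; exact hP.over⟩
  have hmax : (P.under (𝓞 D)).IsMaximal := .of_liesOver_isMaximal _ (span {(q : ℤ)})
  have hbot : P.under (𝓞 D) ≠ ⊥ := ne_bot_of_liesOver_of_ne_bot (p := span {(q : ℤ)})
    (by simpa using (Fact.out : q.Prime).ne_zero) _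
  have : Finite (𝓞 D ⧸ P.under (𝓞 D)) := Ring.HasFiniteQuotients.finiteQuotient hbot
  have : IsGaloisGroup (P.inertia Gal(E/ℚ)) (𝓞 D) (𝓞 E) := .of_isFractionRing _ _ _ D E
  rw [← ramificationIdx_eq_one_iff]
  have htower := ramificationIdx_tower (R := ℤ) (P.under (𝓞 D)) P
  have hcard : Nat.card (P.inertia (P.inertia Gal(E/ℚ))) = P.ramificationIdx (𝓞 D) := by
    rw [card_inertia_eq_ramificationIdxIn (P.under (𝓞 D)) P,
      ramificationIdxIn_eq_ramificationIdx (P.under (𝓞 D)) P (P.inertia Gal(E/ℚ))]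
  have htop : P.inertia (P.inertia Gal(E/ℚ)) = ⊤ := by
    rw [_root_.eq_top_iff]
    exact fun σ _ ↦ σ.2
  rw [← card_inertia_gal_eq_ramificationIdx (q := q) P, ← hcard, htop, Subgroup.card_top] at htower
  exact (Nat.eq_of_mul_eq_mul_right Nat.card_pos (by rw [← htower, one_mul]))

/-- As D is Galois, Minkowski's theorem provides a prime number all of whose primes above ramify; a
single unramified P over p therefore suffices to exclude p. -/
theorem NumberField.finrank_eq_one_of_isUnramifiedAt {D : Type*} [Field D] [NumberField D]
    [IsGalois ℚ D] {p : ℕ}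
    (hunr : ∀ q : ℕ, q.Prime → q ≠ p → IsUnramifiedIn (𝓞 D) (Ideal.span {(q : ℤ)}))
    (P : Ideal (𝓞 D)) [P.IsPrime] [hP : P.LiesOver (Ideal.span {(p : ℤ)})]
    (hunrP : IsUnramifiedAt ℤ P) : Module.finrank ℚ D = 1 := by
  by_contra hrank
  obtain ⟨q, hq, hram⟩ := NumberField.exists_not_isUnramifiedAt_int_of_isGalois (𝒪 := 𝓞 D)
    (lt_of_le_of_ne (Nat.one_le_iff_ne_zero.mpr Module.finrank_pos.ne') (Ne.symm hrank))
  have hmem {q : ℕ} (Q : Ideal (𝓞 D)) (hQ : Q.LiesOver (Ideal.span {(q : ℤ)})) :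
      (q : 𝓞 D) ∈ Q := by
    have : (q : ℤ) ∈ Q.under ℤ := hQ.over ▸ Ideal.mem_span_singleton_self _
    simpa [Ideal.under_def] using this
  rcases eq_or_ne q p with rfl | hqp
  · exact hram P inferInstance (hmem P hP) hunrP
  · have : Fact q.Prime := ⟨hq⟩
    have : (Ideal.span {(q : ℤ)}).IsMaximal := Int.ideal_span_isMaximal_of_prime q
    obtain ⟨⟨Q, hQ, hQq⟩⟩ := (Ideal.span {(q : ℤ)}).nonempty_primesOver (S := 𝓞 D)
    exact hram Q hQ (hmem Q hQq) (hunr q hq hqp Q hQ hQq)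

/-- A form of Minkowski's theorem: an abelian number field in which only `p` ramifies is totally
ramified at `p`. -/
theorem Ideal.inertia_gal_eq_top_of_isUnramifiedIn {E : Type*} [Field E] [NumberField E]
    [IsAbelianGalois ℚ E] {p : ℕ} [Fact p.Prime]
    (hunr : ∀ q : ℕ, q.Prime → q ≠ p → IsUnramifiedIn (𝓞 E) (span {(q : ℤ)}))
    (P : Ideal (𝓞 E)) [P.IsPrime] [hP : P.LiesOver (span {(p : ℤ)})] :
    P.inertia Gal(E/ℚ) = ⊤ := by
  set I := P.inertia Gal(E/ℚ) with hI
  let D : IntermediateField ℚ E := FixedPoints.intermediateField I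
  have hDgal : IsGaloisGroup I D E := IsGaloisGroup.subgroup Gal(E/ℚ) ℚ E I
  have hDab : IsAbelianGalois ℚ D := .tower_bot ℚ D E
  have h𝔭 : (P.under (𝓞 D)).LiesOver (span {(p : ℤ)}) := ⟨by rw [under_under]; exact hP.over⟩
  have hrank : Module.finrank ℚ D = 1 :=
    NumberField.finrank_eq_one_of_isUnramifiedAt (D := D)
      (fun q hq hqp ↦ (hunr q hq hqp).of_tower) (P.under (𝓞 D))
      (isUnramifiedAt_under_of_isGaloisGroup_inertia (q := p) P)
  have h1 := Module.finrank_mul_finrank ℚ D E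
  rw [← IsGaloisGroup.card_eq_finrank I D E, ← IsGalois.card_aut_eq_finrank ℚ E, hrank, one_mul] at h1
  exact Subgroup.eq_top_of_card_eq I h1

end Inertia

/-! ### Galois invariance of the adic valuation -/

section Invariance

open IsDedekindDomain HeightOneSpectrum

open scoped Pointwise in
theorem Ideal.smul_mem_pow_of_smul_eq {R G : Type*} [CommRing R] [Group G] [MulSemiringAction G R]
    {P : Ideal R} {σ : G} (hσ : σ • P = P) {n : ℕ} {r : R} (hr : r ∈ P ^ n) : σ • r ∈ P ^ n := by
  have := Ideal.smul_mem_pointwise_smul σ r _ hr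
  rwa [Ideal.pointwise_smul_def, Ideal.map_pow, ← Ideal.pointwise_smul_def, hσ] at this

variable {R G : Type*} [CommRing R] [IsDedekindDomain R] [Group G] [MulSemiringAction G R]

open scoped Pointwise in
theorem IsDedekindDomain.HeightOneSpectrum.intValuation_smul (P : HeightOneSpectrum R)
    (hG : ∀ σ : G, σ • P.asIdeal = P.asIdeal) (σ : G) (r : R) :
    P.intValuation (σ • r) = P.intValuation r := by
  have key (σ : G) (r : R) : P.intValuation (σ • r) ≤ P.intValuation r := by
    rcases eq_or_ne r 0 with rfl | hr
    · simp
    have h := P.intValuation_eq_exp_neg_multiplicity hr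
    rw [h, P.intValuation_le_pow_iff_mem]
    exact Ideal.smul_mem_pow_of_smul_eq (hG σ) ((P.intValuation_le_pow_iff_mem _ _).mp h.le)
  refine le_antisymm (key σ r) ?_
  simpa using key σ⁻¹ (σ • r)

end Invariance

/-! ### The degree bound and ramification in composita -/

section GlobalToLocal

open Algebra

/-- For odd `p`, there is no elementary abelian number field of degree `p ^ 2` in which only `p`
ramifies. -/
theorem NumberField.finrank_ne_sq_of_isUnramifiedIn {E : Type*} [Field E] [NumberField E]
    [IsAbelianGalois ℚ E] {p : ℕ} (hp : p.Prime) (hp2 : p ≠ 2)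
    (hexp : ∀ σ : Gal(E/ℚ), σ ^ p = 1)
    (hunr : ∀ q : ℕ, q.Prime → q ≠ p → IsUnramifiedIn (𝓞 E) (Ideal.span {(q : ℤ)})) :
    Module.finrank ℚ E ≠ p ^ 2 := by
  intro hn
  have : Fact p.Prime := ⟨hp⟩
  have hmax : (Ideal.span {(p : ℤ)}).IsMaximal := Int.ideal_span_isMaximal_of_prime p
  have hbot : Ideal.span {(p : ℤ)} ≠ ⊥ := by simpa using hp.ne_zero
  obtain ⟨⟨P, hP, hPp⟩⟩ := (Ideal.span {(p : ℤ)}).nonempty_primesOver (S := 𝓞 E)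
  have hin := P.inertia_gal_eq_top_of_isUnramifiedIn (E := E) hunr
  have he : P.ramificationIdx ℤ = p ^ 2 := by
    rw [← P.card_inertia_gal_eq_ramificationIdx (q := p), hin, Subgroup.card_top,
      IsGalois.card_aut_eq_finrank, hn]
  let w : IsDedekindDomain.HeightOneSpectrum (𝓞 E) :=
    ⟨P, hP, Ideal.ne_bot_of_liesOver_of_ne_bot hbot P⟩
  obtain ⟨π, hπ⟩ := w.valuation_exists_uniformizer' E
  refine Valuation.false_of_totallyRamified_of_finrank_eq_sq (v := w.valuation E) hp hp2 hn ?_ hπ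
    ?_ hexp fun σ τ ↦ IsMulCommutative.is_comm.comm σ τ
  · have hmap : (Ideal.span {(p : ℤ)}).map (algebraMap ℤ (𝓞 E)) = Ideal.span {(p : 𝓞 E)} := by
      rw [Ideal.map_span]; simp
    rw [Ideal.IsDedekindDomain.ramificationIdx_eq_multiplicity (Ideal.span {(p : ℤ)}) P
      (Ideal.map_ne_bot_of_ne_bot hbot), hmap] at he
    have h := w.valuation_of_algebraMap (K := E) (p : 𝓞 E)
    rw [w.intValuation_eq_exp_neg_multiplicity (by simpa using hp.ne_zero), he] at h
    simpa using h
  · intro σ x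
    -- Inertia is the whole group, so every σ stabilizes P and hence preserves its valuation.
    have hσ (σ : Gal(E/ℚ)) := Ideal.inertia_le_stabilizer (M := Gal(E/ℚ)) P (hin ▸ Subgroup.mem_top σ)
    obtain ⟨r, s, -, rfl⟩ := IsFractionRing.div_surjective (A := 𝓞 E) x
    have hr (r : 𝓞 E) : w.valuation E (σ (algebraMap (𝓞 E) E r)) =
        w.valuation E (algebraMap (𝓞 E) E r) := by
      have : σ (algebraMap (𝓞 E) E r) = algebraMap (𝓞 E) E (σ • r) := rfl
      rw [this, w.valuation_of_algebraMap, w.valuation_of_algebraMap,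
        w.intValuation_smul (G := Gal(E/ℚ)) hσ]
    rw [map_div₀, map_div₀, map_div₀, hr, hr]

/-- For odd `p`, an elementary abelian `p`-extension of `ℚ` in which only `p` ramifies has degree
at most `p`. -/
theorem NumberField.finrank_le_of_isUnramifiedIn {E : Type*} [Field E] [NumberField E]
    [IsAbelianGalois ℚ E] {p : ℕ} (hp : p.Prime) (hp2 : p ≠ 2)
    (hexp : ∀ σ : Gal(E/ℚ), σ ^ p = 1)
    (hunr : ∀ q : ℕ, q.Prime → q ≠ p → IsUnramifiedIn (𝓞 E) (Ideal.span {(q : ℤ)})) :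
    Module.finrank ℚ E ≤ p := by
  have : Fact p.Prime := ⟨hp⟩
  by_contra! hlt
  have hpg : IsPGroup p Gal(E/ℚ) := fun σ ↦ ⟨1, by simpa using hexp σ⟩
  obtain ⟨k, hk⟩ := (IsPGroup.iff_card (p := p)).mp hpg
  have hk2 : 2 ≤ k := by
    rw [IsGalois.card_aut_eq_finrank] at hk
    rw [hk] at hlt
    have : 1 < k := by rw [← Nat.pow_lt_pow_iff_right hp.one_lt]; simpa using hlt
    omega
  -- A subgroup of order p ^ (k - 2) has a fixed field of degree p², already excluded.
  obtain ⟨H, hH⟩ := Sylow.exists_subgroup_card_pow_prime (G := Gal(E/ℚ)) p (n := k - 2)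
    (hk ▸ pow_dvd_pow p (Nat.sub_le k 2))
  let D : IntermediateField ℚ E := FixedPoints.intermediateField H
  have hDgal : IsGaloisGroup H D E := IsGaloisGroup.subgroup Gal(E/ℚ) ℚ E H
  have hDab : IsAbelianGalois ℚ D := .tower_bot ℚ D E
  refine NumberField.finrank_ne_sq_of_isUnramifiedIn (E := D) hp hp2 (fun σ ↦ ?_)
    (fun q hq hqp ↦ (hunr q hq hqp).of_tower) ?_
  · obtain ⟨τ, rfl⟩ := AlgEquiv.restrictNormalHom_surjective E σ
    rw [← map_pow, hexp, map_one]
  · have h1 := Module.finrank_mul_finrank ℚ D E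
    rw [← IsGaloisGroup.card_eq_finrank H D E, ← IsGalois.card_aut_eq_finrank ℚ E, hk, hH] at h1
    have h2 : p ^ k = p ^ 2 * p ^ (k - 2) := by rw [← pow_add, Nat.add_sub_cancel' hk2]
    rw [h2] at h1
    exact Nat.eq_of_mul_eq_mul_right (pow_pos hp.pos _) h1

/-- Restriction to F sends inertia at Q into inertia at the prime below, which is trivial. -/
theorem Ideal.apply_algebraMap_eq_of_mem_inertia {F M : Type*} [Field F] [Field M] [NumberField F]
    [NumberField M] [Algebra F M] [IsGalois ℚ F] [IsGalois ℚ M] {q : ℕ} [Fact q.Prime]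
    (h : IsUnramifiedIn (𝓞 F) (span {(q : ℤ)})) (Q : Ideal (𝓞 M)) [Q.IsPrime]
    [hQ : Q.LiesOver (span {(q : ℤ)})] {σ : Gal(M/ℚ)} (hσ : σ ∈ Q.inertia Gal(M/ℚ)) (x : F) :
    σ (algebraMap F M x) = algebraMap F M x := by
  let σ' := IsGaloisGroup.restrictHom Gal(M/ℚ) Gal(F/ℚ) ℤ (𝓞 F) (𝓞 M) σ
  have hσ' (y : 𝓞 F) : algebraMap (𝓞 F) (𝓞 M) (σ' • y) = σ • algebraMap (𝓞 F) (𝓞 M) y :=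
    IsGaloisGroup.algebraMap_restrictHom_smul ..
  have hlies : (Q.under (𝓞 F)).LiesOver (span {(q : ℤ)}) := ⟨by rw [under_under]; exact hQ.over⟩
  have hbot := (inertia_gal_eq_bot_iff (q := q) (Q.under (𝓞 F))).mpr (h _ inferInstance hlies)
  have hmem : σ' ∈ (Q.under (𝓞 F)).inertia Gal(F/ℚ) := by
    intro y
    change algebraMap (𝓞 F) (𝓞 M) (σ' • y - y) ∈ Q
    rw [_root_.map_sub, hσ']
    exact hσ _
  rw [hbot, Subgroup.mem_bot] at hmem
  have hint (y : 𝓞 F) : σ (algebraMap F M (y : F)) = algebraMap F M (y : F) := by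
    have := hσ' y
    rw [hmem, one_smul] at this
    exact (congrArg (algebraMap (𝓞 M) M) this).symm
  obtain ⟨r, s, -, rfl⟩ := IsFractionRing.div_surjective (A := 𝓞 F) x
  rw [map_div₀, map_div₀, hint, hint]

/-- A Galois number field generated by two Galois subfields in which `q` is unramified is
unramified at `q`. -/
theorem Algebra.IsUnramifiedIn.of_compositum {F₁ F₂ M : Type*} [Field F₁] [Field F₂] [Field M]
    [NumberField F₁] [NumberField F₂] [NumberField M] [Algebra F₁ M] [Algebra F₂ M]
    [IsGalois ℚ F₁] [IsGalois ℚ F₂] [IsGalois ℚ M] {q : ℕ} (hq : q.Prime)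
    (h₁ : IsUnramifiedIn (𝓞 F₁) (Ideal.span {(q : ℤ)}))
    (h₂ : IsUnramifiedIn (𝓞 F₂) (Ideal.span {(q : ℤ)}))
    (hM : ∀ σ : Gal(M/ℚ), (∀ x : F₁, σ (algebraMap F₁ M x) = algebraMap F₁ M x) →
      (∀ x : F₂, σ (algebraMap F₂ M x) = algebraMap F₂ M x) → σ = 1) :
    IsUnramifiedIn (𝓞 M) (Ideal.span {(q : ℤ)}) := by
  have : Fact q.Prime := ⟨hq⟩
  intro Q hQ hQq
  rw [← Ideal.inertia_gal_eq_bot_iff (q := q), eq_bot_iff]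
  exact fun σ hσ ↦ hM σ (Ideal.apply_algebraMap_eq_of_mem_inertia h₁ Q hσ)
    (Ideal.apply_algebraMap_eq_of_mem_inertia h₂ Q hσ)

end GlobalToLocal

/-- By `hM`, Gal(M/ℚ) embeds in the product of the two Galois groups, so it inherits commutativity
and exponent dividing p. -/
theorem NumberField.finrank_le_of_compositum {F₁ F₂ M : Type*} [Field F₁] [Field F₂] [Field M]
    [NumberField F₁] [NumberField F₂] [NumberField M] [Algebra F₁ M] [Algebra F₂ M]
    [IsAbelianGalois ℚ F₁] [IsAbelianGalois ℚ F₂] [IsGalois ℚ M] {p : ℕ} (hp : p.Prime)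
    (hp2 : p ≠ 2) (hexp₁ : ∀ σ : Gal(F₁/ℚ), σ ^ p = 1) (hexp₂ : ∀ σ : Gal(F₂/ℚ), σ ^ p = 1)
    (h₁ : ∀ q : ℕ, q.Prime → q ≠ p → Algebra.IsUnramifiedIn (𝓞 F₁) (Ideal.span {(q : ℤ)}))
    (h₂ : ∀ q : ℕ, q.Prime → q ≠ p → Algebra.IsUnramifiedIn (𝓞 F₂) (Ideal.span {(q : ℤ)}))
    (hM : ∀ σ : Gal(M/ℚ), (∀ x : F₁, σ (algebraMap F₁ M x) = algebraMap F₁ M x) →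
      (∀ x : F₂, σ (algebraMap F₂ M x) = algebraMap F₂ M x) → σ = 1) :
    Module.finrank ℚ M ≤ p := by
  have hker {σ : Gal(M/ℚ)} (h₁ : AlgEquiv.restrictNormalHom F₁ σ = 1)
      (h₂ : AlgEquiv.restrictNormalHom F₂ σ = 1) : σ = 1 := by
    refine hM σ (fun x ↦ ?_) fun x ↦ ?_
    · rw [← AlgEquiv.restrictNormal_commutes]
      exact congrArg _ (DFunLike.congr_fun h₁ x)
    · rw [← AlgEquiv.restrictNormal_commutes]
      exact congrArg _ (DFunLike.congr_fun h₂ x)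
  have hcomm (σ τ : Gal(M/ℚ)) : σ * τ = τ * σ := by
    rw [← commutatorElement_eq_one_iff_mul_comm]
    refine hker ?_ ?_ <;> rw [map_commutatorElement, commutatorElement_eq_one_iff_mul_comm] <;>
      exact IsMulCommutative.is_comm.comm _ _
  have : IsAbelianGalois ℚ M := { is_comm.comm := hcomm }
  refine NumberField.finrank_le_of_isUnramifiedIn hp hp2 (fun σ ↦ hker ?_ ?_) fun q hq hqp ↦
    .of_compositum hq (h₁ q hq hqp) (h₂ q hq hqp) hM
  · rw [map_pow, hexp₁]
  · rw [map_pow, hexp₂]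

/-! ### Composita inside Ω -/

section Subfields

variable {Ω : Type*} [Field Ω] [CharZero Ω] {p : ℕ}

theorem IntermediateField.numberField_of_finiteDimensional (E : IntermediateField ℚ Ω)
    [FiniteDimensional ℚ E] : NumberField E where

theorem IntermediateField.eq_one_of_forall_apply_eq_of_sup {F L : Type*} [Field F] [Field L]
    [Algebra F L] {A B M : IntermediateField F L} (hA : A ≤ M) (hB : B ≤ M) (hM : M = A ⊔ B)
    {σ : Gal(M/F)} (h₁ : ∀ x : A, σ (inclusion hA x) = inclusion hA x)
    (h₂ : ∀ x : B, σ (inclusion hB x) = inclusion hB x) : σ = 1 := by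
  let S : IntermediateField F L := lift (F := M) (fixedField (Subgroup.zpowers σ))
  have hfix {x : L} (hx : x ∈ M) (h : σ ⟨x, hx⟩ = ⟨x, hx⟩) : x ∈ S := by
    refine (mem_lift (⟨x, hx⟩ : M)).mpr ?_
    rintro ⟨τ, hτ⟩
    have : Subgroup.zpowers σ ≤ MulAction.stabilizer Gal(M/F) (⟨x, hx⟩ : M) :=
      Subgroup.zpowers_le.mpr h
    exact this hτ
  have hle : M ≤ S := by
    conv_lhs => rw [hM]
    exact sup_le (fun x hx ↦ hfix (hA hx) (h₁ ⟨x, hx⟩)) fun x hx ↦ hfix (hB hx) (h₂ ⟨x, hx⟩)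
  ext x
  have hx := (mem_lift x).mp (hle x.2)
  exact congrArg Subtype.val (hx ⟨σ, Subgroup.mem_zpowers σ⟩)

theorem IntermediateField.isGalois_sup {F L : Type*} [Field F] [Field L] [Algebra F L]
    (A B : IntermediateField F L) [IsGalois F A] [IsGalois F B] :
    IsGalois F (A ⊔ B : IntermediateField F L) := by
  have : Algebra.IsSeparable F (A ⊔ B : IntermediateField F L) := inferInstance
  exact { }

/-- The key inclusion: an abelian subfield of exponent dividing `p` in which only the odd prime `p`
ramifies is contained in any such subfield of degree `p`. -/
theorem IntermediateField.le_of_finrank_eq_prime (hp : p.Prime) (hp2 : p ≠ 2)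
    {A B : IntermediateField ℚ Ω} [FiniteDimensional ℚ A] [FiniteDimensional ℚ B]
    [IsAbelianGalois ℚ A] [IsAbelianGalois ℚ B]
    (hexpA : ∀ σ : Gal(A/ℚ), σ ^ p = 1) (hexpB : ∀ σ : Gal(B/ℚ), σ ^ p = 1)
    (hA : ∀ q : ℕ, q.Prime → q ≠ p → Algebra.IsUnramifiedIn (𝓞 A) (Ideal.span {(q : ℤ)}))
    (hB : ∀ q : ℕ, q.Prime → q ≠ p → Algebra.IsUnramifiedIn (𝓞 B) (Ideal.span {(q : ℤ)}))
    (hrank : Module.finrank ℚ B = p) : A ≤ B := by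
  obtain ⟨M, hM⟩ : ∃ M, M = A ⊔ B := ⟨_, rfl⟩
  have hAM : A ≤ M := hM ▸ le_sup_left
  have hBM : B ≤ M := hM ▸ le_sup_right
  have : FiniteDimensional ℚ M := hM ▸ inferInstance
  have : NumberField A := A.numberField_of_finiteDimensional
  have : NumberField B := B.numberField_of_finiteDimensional
  have : NumberField M := M.numberField_of_finiteDimensional
  have hA' : IsGalois ℚ A := inferInstance
  have hB' : IsGalois ℚ B := inferInstance
  have : IsGalois ℚ M := by
    rw [hM]
    exact @isGalois_sup ℚ Ω _ _ _ A B hA' hB'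
  let : Algebra A M := (inclusion hAM).toRingHom.toAlgebra
  let : Algebra B M := (inclusion hBM).toRingHom.toAlgebra
  have hle : Module.finrank ℚ M ≤ p :=
    NumberField.finrank_le_of_compositum (F₁ := A) (F₂ := B) hp hp2 hexpA hexpB hA hB
      fun σ h₁ h₂ ↦ eq_one_of_forall_apply_eq_of_sup hAM hBM hM h₁ h₂
  have : B = M := IntermediateField.eq_of_le_of_finrank_le hBM (hrank ▸ hle)
  exact this ▸ hAM

end Subfields

/-! ### Cyclotomic fields and subfields of cyclic extensions -/

section Cyclotomic

theorem IsPrimitiveRoot.isCyclotomicExtension_adjoin_simple {F L : Type*} [Field F] [Field L]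
    [Algebra F L] {n : ℕ} [NeZero n] {ζ : L} (hζ : IsPrimitiveRoot ζ n) :
    IsCyclotomicExtension {n} F F⟮ζ⟯ := by
  change IsCyclotomicExtension {n} F F⟮ζ⟯.toSubalgebra
  rw [IntermediateField.adjoin_simple_toSubalgebra_of_isAlgebraic
    ((hζ.isIntegral (NeZero.pos n)).tower_top (A := F)).isAlgebraic]
  exact hζ.adjoin_isCyclotomicExtension F

theorem IsCyclotomicExtension.isUnramifiedIn_of_not_dvd {C : Type*} [Field C] [NumberField C]
    {m : ℕ} [NeZero m] [IsCyclotomicExtension {m} ℚ C] {q : ℕ} (hq : q.Prime) (hqm : ¬ q ∣ m) :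
    Algebra.IsUnramifiedIn (𝓞 C) (Ideal.span {(q : ℤ)}) := by
  have : Fact q.Prime := ⟨hq⟩
  intro Q hQ hQq
  rw [← Ideal.ramificationIdx_eq_one_iff]
  exact IsCyclotomicExtension.Rat.ramificationIdx_eq_of_not_dvd (m := m) q C Q hqm

theorem IsCyclic.exists_subgroup_card_eq {G : Type*} [Group G] [Finite G] [IsCyclic G] {d : ℕ}
    (hd : d ∣ Nat.card G) : ∃ H : Subgroup G, Nat.card H = d := by
  obtain ⟨g, hg⟩ := IsCyclic.exists_generator (α := G)
  obtain ⟨k, hk⟩ := hd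
  have hpos : 0 < Nat.card G := Nat.card_pos
  have hk0 : k ≠ 0 := by rintro rfl; simp [hk] at hpos
  refine ⟨Subgroup.zpowers (g ^ k), ?_⟩
  rw [Nat.card_zpowers, orderOf_pow_of_dvd hk0 ⟨d, by
    rw [orderOf_eq_card_of_forall_mem_zpowers hg, hk, mul_comm]⟩,
    orderOf_eq_card_of_forall_mem_zpowers hg, hk, Nat.mul_div_cancel _ (Nat.pos_of_ne_zero hk0)]

/-- A finite cyclic extension has subextensions of each degree dividing its degree. -/
theorem IntermediateField.exists_le_finrank_eq_of_isCyclic {F L : Type*} [Field F] [Field L]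
    [Algebra F L] (C : IntermediateField F L) [FiniteDimensional F C] [IsGalois F C]
    [IsCyclic Gal(C/F)] {d e : ℕ} (hde : Module.finrank F C = d * e) (he : e ≠ 0) :
    ∃ K ≤ C, Module.finrank F K = d := by
  obtain ⟨H, hH⟩ := IsCyclic.exists_subgroup_card_eq (G := Gal(C/F)) (d := e)
    (by rw [IsGalois.card_aut_eq_finrank, hde]; exact dvd_mul_left e d)
  refine ⟨lift (fixedField H), lift_le _, ?_⟩
  rw [← (liftAlgEquiv (fixedField H)).toLinearEquiv.finrank_eq]
  have h := Module.finrank_mul_finrank F (fixedField H) C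
  rw [finrank_fixedField_eq_card, hH, hde] at h
  exact Nat.eq_of_mul_eq_mul_right (Nat.pos_of_ne_zero he) h

end Cyclotomic

/-! ### The largest extension -/

section Main

theorem IntermediateField.isAbelianGalois_of_le {F L : Type*} [Field F] [Field L]
    [Algebra F L] {A B : IntermediateField F L} (h : A ≤ B) [IsAbelianGalois F B] :
    IsAbelianGalois F A := .of_algHom (inclusion h)

theorem IntermediateField.pow_eq_one_of_le {F L : Type*} [Field F] [Field L]
    [Algebra F L] {A B : IntermediateField F L} (h : A ≤ B) [IsGalois F A] [IsGalois F B] {n : ℕ}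
    (hB : ∀ σ : Gal(B/F), σ ^ n = 1) (σ : Gal(A/F)) : σ ^ n = 1 := by
  let : Algebra A B := (inclusion h).toRingHom.toAlgebra
  have : IsScalarTower F A B := .of_algebraMap_eq' rfl
  obtain ⟨τ, rfl⟩ := AlgEquiv.restrictNormalHom_surjective (F := F) (K₁ := A) B σ
  rw [← map_pow, hB, map_one]

theorem IntermediateField.isAbelianOfExponent_of_le_of_finrank_eq_prime {F L : Type*} [Field F]
    [Field L] [Algebra F L] {K C : IntermediateField F L} {p : ℕ} (hp : p.Prime) (hKC : K ≤ C)
    [IsAbelianGalois F C] (hK : Module.finrank F K = p) :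
    K.IsAbelianOfExponent p ∧ K.IsCyclicExtension := by
  have hab : IsAbelianGalois F K := isAbelianGalois_of_le hKC
  have : FiniteDimensional F K := .of_finrank_pos (hK ▸ hp.pos)
  have : Fact p.Prime := ⟨hp⟩
  have hcard : Nat.card Gal(K/F) = p := by rw [IsGalois.card_aut_eq_finrank, hK]
  have hcyc : IsCyclic Gal(K/F) := isCyclic_of_prime_card hcard
  exact ⟨⟨hab, IsCyclic.exponent_eq_card.trans hcard⟩, inferInstance, hcyc⟩

variable {Ω : Type*} [Field Ω] [CharZero Ω] {p : ℕ}

theorem UnramifiedOutside.of_isPrimitiveRoot {n : ℕ} (hp : p.Prime) {ζ : Ω}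
    (hζ : IsPrimitiveRoot ζ (p ^ n)) : UnramifiedOutside p ℚ⟮ζ⟯ := by
  have : NeZero (p ^ n) := ⟨pow_ne_zero n hp.ne_zero⟩
  have hcyc : IsCyclotomicExtension {p ^ n} ℚ ℚ⟮ζ⟯ := hζ.isCyclotomicExtension_adjoin_simple
  have : FiniteDimensional ℚ ℚ⟮ζ⟯ := IsCyclotomicExtension.finiteDimensional {p ^ n} ℚ ℚ⟮ζ⟯
  have : NumberField ℚ⟮ζ⟯ := ℚ⟮ζ⟯.numberField_of_finiteDimensional
  intro E hE hfin q hq hqp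
  have : NumberField E := E.numberField_of_finiteDimensional
  let : Algebra E ℚ⟮ζ⟯ := (IntermediateField.inclusion hE).toRingHom.toAlgebra
  refine Algebra.IsUnramifiedIn.of_tower (F := E) (E := ℚ⟮ζ⟯) ?_
  exact IsCyclotomicExtension.isUnramifiedIn_of_not_dvd (m := p ^ n) hq
    fun h ↦ hqp ((Nat.prime_dvd_prime_iff_eq hq hp).mp (hq.dvd_of_dvd_pow h))

theorem le_of_mem_abelianExponentUnramifiedOutside (hp : p.Prime) (hp2 : p ≠ 2)
    {K L : IntermediateField ℚ Ω} (hL : L ∈ abelianExponentUnramifiedOutside Ω p)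
    (hLp : Module.finrank ℚ L = p) (hK : K ∈ abelianExponentUnramifiedOutside Ω p) : K ≤ L := by
  obtain ⟨⟨hKab, hKexp⟩, hKunr⟩ := hK
  obtain ⟨⟨hLab, hLexp⟩, hLunr⟩ := hL
  have : FiniteDimensional ℚ L := .of_finrank_pos (hLp ▸ hp.pos)
  -- K may be infinite over ℚ, so the inclusion is checked on each finite subextension ℚ(x).
  intro x hx
  have hxK : ℚ⟮x⟯ ≤ K := IntermediateField.adjoin_simple_le_iff.mpr hx
  have hint : IsIntegral ℚ x :=
    (hKab.toIsGalois.to_isSeparable.isAlgebraic.isAlgebraic ⟨x, hx⟩).isIntegral.map K.val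
  have : FiniteDimensional ℚ ℚ⟮x⟯ := IntermediateField.adjoin.finiteDimensional hint
  have hab : IsAbelianGalois ℚ ℚ⟮x⟯ := @IntermediateField.isAbelianGalois_of_le _ _ _ _ _ _ _ hxK hKab
  refine @IntermediateField.le_of_finrank_eq_prime Ω _ _ p hp hp2 ℚ⟮x⟯ L ‹_› ‹_› hab hLab ?_ ?_
    (hKunr _ hxK inferInstance) (hLunr L le_rfl inferInstance) hLp
    x (IntermediateField.mem_adjoin_simple_self ℚ x)
  · exact @IntermediateField.pow_eq_one_of_le _ _ _ _ _ _ _ hxK hab.toIsGalois hKab.toIsGalois p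
      fun σ ↦ hKexp ▸ Monoid.pow_exponent_eq_one σ
  · exact fun σ ↦ hLexp ▸ Monoid.pow_exponent_eq_one σ

theorem exists_isGreatest_abelianExponentUnramifiedOutside (hp : p.Prime) (hp2 : p ≠ 2) {ζ : Ω}
    (hζ : IsPrimitiveRoot ζ (p ^ 2)) :
    ∃ K : IntermediateField ℚ Ω,
      IsGreatest (abelianExponentUnramifiedOutside Ω p) K ∧
      K.IsCyclicExtension ∧
      ∀ K' : IntermediateField ℚ Ω,
        (K' ≤ ℚ⟮ζ⟯ ∧ Module.finrank ℚ K' = p) ↔ K' = K := by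
  have : NeZero (p ^ 2) := ⟨pow_ne_zero 2 hp.ne_zero⟩
  have hcyc : IsCyclotomicExtension {p ^ 2} ℚ ℚ⟮ζ⟯ := hζ.isCyclotomicExtension_adjoin_simple
  have : FiniteDimensional ℚ ℚ⟮ζ⟯ := IsCyclotomicExtension.finiteDimensional {p ^ 2} ℚ ℚ⟮ζ⟯
  have : NumberField ℚ⟮ζ⟯ := ℚ⟮ζ⟯.numberField_of_finiteDimensional
  have hab : IsAbelianGalois ℚ ℚ⟮ζ⟯ := IsCyclotomicExtension.isAbelianGalois {p ^ 2} ℚ ℚ⟮ζ⟯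
  have hgal : IsGalois ℚ ℚ⟮ζ⟯ := inferInstance
  -- Oddness of p makes the units modulo p² cyclic.
  have hunits : IsCyclic (ZMod (p ^ 2))ˣ := ZMod.isCyclic_units_of_prime_pow p hp hp2 2
  have hcyclic : IsCyclic Gal(ℚ⟮ζ⟯/ℚ) :=
    (IsCyclotomicExtension.Rat.galEquivZMod (p ^ 2) ℚ⟮ζ⟯).isCyclic.mpr hunits
  have hrank : Module.finrank ℚ ℚ⟮ζ⟯ = p * (p - 1) := by
    rw [IsCyclotomicExtension.finrank (n := p ^ 2) ℚ⟮ζ⟯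
      (Polynomial.cyclotomic.irreducible_rat (NeZero.pos _)), Nat.totient_prime_pow hp two_pos]
    simp
  obtain ⟨K, hKC, hK⟩ := @IntermediateField.exists_le_finrank_eq_of_isCyclic ℚ Ω _ _ _ ℚ⟮ζ⟯
    ‹_› hgal hcyclic p (p - 1) hrank (Nat.sub_pos_of_lt hp.one_lt).ne'
  have hmem {K' : IntermediateField ℚ Ω} (hK'C : K' ≤ ℚ⟮ζ⟯) (hK' : Module.finrank ℚ K' = p) :
      K' ∈ abelianExponentUnramifiedOutside Ω p ∧ K'.IsCyclicExtension := by
    obtain ⟨h₁, h₂⟩ := @IntermediateField.isAbelianOfExponent_of_le_of_finrank_eq_prime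
      _ _ _ _ _ _ _ _ hp hK'C hab hK'
    exact ⟨⟨h₁, fun E hE ↦ UnramifiedOutside.of_isPrimitiveRoot hp hζ E (hE.trans hK'C)⟩, h₂⟩
  have hgreat : IsGreatest (abelianExponentUnramifiedOutside Ω p) K :=
    ⟨(hmem hKC hK).1, fun K' hK' ↦
      le_of_mem_abelianExponentUnramifiedOutside hp hp2 (hmem hKC hK).1 hK hK'⟩
  refine ⟨K, hgreat, (hmem hKC hK).2, fun K' ↦ ⟨fun ⟨hK'C, hK'⟩ ↦ ?_, ?_⟩⟩
  · have : FiniteDimensional ℚ K := .of_finrank_pos (hK ▸ hp.pos)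
    -- Uniqueness follows from maximality: K' belongs to the set, so it lies in K, and the degrees
    -- agree.
    exact IntermediateField.eq_of_le_of_finrank_eq (hgreat.2 (hmem hK'C hK').1) (hK'.trans hK.symm)
  · rintro rfl
    exact ⟨hKC, hK⟩

end Main

theorem mainTheorem2 {Ω : Type*} [Field Ω] [Algebra ℚ Ω] [IsAlgClosed Ω]
    (p : ℕ) (hp : p.Prime) (hp2 : p ≠ 2) (ζ : Ω) (hζ : IsPrimitiveRoot ζ (p ^ 2)) :
    ∃ K : IntermediateField ℚ Ω,
      IsGreatest (abelianExponentUnramifiedOutside Ω p) K ∧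
      K.IsCyclicExtension ∧
      ∀ K' : IntermediateField ℚ Ω,
        (K' ≤ ℚ⟮ζ⟯ ∧ Module.finrank ℚ K' = p) ↔ K' = K := by
  have : CharZero Ω := algebraRat.charZero Ω
  -- The given ℚ-algebra structure is generalized so that it can be replaced by the canonical one,
  -- to which it is equal by uniqueness.
  have key (a : Algebra ℚ Ω) : ∃ K : IntermediateField ℚ Ω,
      IsGreatest (abelianExponentUnramifiedOutside Ω p) K ∧
      K.IsCyclicExtension ∧
      ∀ K' : IntermediateField ℚ Ω,
        (K' ≤ ℚ⟮ζ⟯ ∧ Module.finrank ℚ K' = p) ↔ K' = K := by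
    obtain rfl : a = DivisionRing.toRatAlgebra := Subsingleton.elim _ _
    exact exists_isGreatest_abelianExponentUnramifiedOutside hp hp2 hζ
  exact key _
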